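/- Let $p$ be a prime with $p \equiv 1 \pmod 8$, and let $E$ be the elliptic curve $y^2 = x^3 - p^2 x$ over $\mathbb{Q}$. Suppose that the following two conditions hold: (1) there are $a, b \in \mathbb{N}$ such that $p = a + b$ and both $a - b$ and $a^2 + b^2$ are squares of integers; (2) there are $a, b \in \mathbb{N}$ such that $p = a^2 + b^2$, $\gcd(a, 2b) = 1$, and at least one of the integers $(a + 2b)^2 + b^2$ and $(a - 2b)^2 + b^2$ is the square of an integer. Then the group $E(\mathbb{Q})$ of rational points of $E$ has rank $2$. -/

import Mathlib

/-- The congruent number elliptic curve `y² = x³ - n² x` over `ℚ`. -/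
def congruentCurve (n : ℕ) : WeierstrassCurve ℚ where
  a₁ := 0
  a₂ := 0
  a₃ := 0
  a₄ := -(n : ℚ) ^ 2
  a₆ := 0

/-- The rank of the group `E(ℚ)` of rational points of a Weierstrass curve `E` over `ℚ`: the maximal
number of `ℤ`-linearly independent rational points. -/
noncomputable def mordellWeilRank (E : WeierstrassCurve ℚ) : ℕ :=
  Module.finrank ℤ E.toAffine.Point

/-! Complete 2-descent with both bounds explicit. Since x(x - p)(x + p) is a square, the square
class of x can only involve the sign and p, and that of x - p only the sign, 2 and p. If x > 0 then
x - p > 0 is automatic, so four parities decide whether a point lies in 2E(ℚ): `twoDescent` embeds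
E(ℚ)/2E(ℚ) in 𝔽₂⁴ (`ker_twoDescent`). Hence 2E(ℚ) has finite index, and heights give finite
generation (`fg_of_finiteIndex`). With four rational 2-torsion points, [E(ℚ) : 2E(ℚ)] = 4 · 2 ^
rank, so rank 2 amounts to surjectivity of `twoDescent`. The torsion points (0, 0) and (p, 0) supply
two classes. Condition (1) supplies a point with x a square and x - p twice a square, condition (2)
one with x a square and x - p equal to p times a square. The four classes form a basis of 𝔽₂⁴. -/

section
open Module

/-! ### Index of kG in a finitely generated abelian group -/

/-- For a finite commutative group, multiplication by `k` has cokernel and kernel of equal size. -/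
lemma AddCommGroup.index_range_nsmul_of_finite (T : Type*) [AddCommGroup T] [Finite T] (k : ℕ) :
    (nsmulAddMonoidHom (α := T) k).range.index = Nat.card (nsmulAddMonoidHom (α := T) k).ker := by
  have h₁ := (nsmulAddMonoidHom (α := T) k).ker.card_mul_index
  rw [AddSubgroup.index_ker] at h₁
  have h₂ := (nsmulAddMonoidHom (α := T) k).range.index_mul_card
  exact Nat.eq_of_mul_eq_mul_right Nat.card_pos (h₂.trans h₁.symm)

/-- The image of multiplication by k is the kernel of coordinatewise reduction onto (ℤ/k)^r. -/
lemma AddCommGroup.index_range_nsmul_finsupp (r k : ℕ) [NeZero k] :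
    (nsmulAddMonoidHom (α := Fin r →₀ ℤ) k).range.index = k ^ r := by
  let f : (Fin r →₀ ℤ) →+ (Fin r →₀ ZMod k) :=
    Finsupp.mapRange.addMonoidHom (Int.castAddHom (ZMod k))
  have hf : f.ker = (nsmulAddMonoidHom (α := Fin r →₀ ℤ) k).range := by
    ext v
    simp only [AddMonoidHom.mem_ker, AddMonoidHom.mem_range, nsmulAddMonoidHom_apply]
    constructor
    · intro hv
      have h (i) : (k : ℤ) ∣ v i := by
        rw [← ZMod.intCast_zmod_eq_zero_iff_dvd]
        simpa [f] using DFunLike.congr_fun hv i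
      choose w hw using h
      refine ⟨Finsupp.equivFunOnFinite.symm w, ?_⟩
      ext i
      simp [hw]
    · rintro ⟨w, rfl⟩
      ext i
      simp [f]
  have hs : Function.Surjective f :=
    Finsupp.mapRange_surjective _ (map_zero _) ZMod.intCast_surjective
  rw [← hf, AddSubgroup.index_ker, AddMonoidHom.range_eq_top.mpr hs]
  simp

/-- In a finitely generated commutative group, `[G : kG] = k ^ rank G * #G[k]`. -/
lemma AddCommGroup.index_range_nsmul (G : Type*) [AddCommGroup G] [AddGroup.FG G] (k : ℕ)
    [NeZero k] : (nsmulAddMonoidHom (α := G) k).range.index =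
      k ^ finrank ℤ G * Nat.card (nsmulAddMonoidHom (α := G) k).ker := by
  -- Write G = ℤ^r × T with T finite. The index is multiplicative: ℤ^r contributes k ^ r and T
  -- contributes #T[k], which is #G[k] because ℤ^r is torsion-free.
  obtain ⟨r, ι, _, p, hp, e, ⟨φ⟩⟩ := AddCommGroup.equiv_free_prod_directSum_zmod (G := G)
  have (i : ι) : NeZero (p i ^ e i) := ⟨pow_ne_zero _ (hp i).ne_zero⟩
  classical
  let T := DirectSum ι fun i ↦ ZMod (p i ^ e i)
  have : Finite T := Finite.of_equiv _ DFinsupp.equivFunOnFintype.symm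
  have hr : finrank ℤ G = r := by
    have : Module.Finite ℤ T := Module.Finite.of_finite
    have h := (LinearMap.fst ℤ (Fin r →₀ ℤ) T).ker.finrank_quotient_add_finrank
    rw [(LinearMap.fst ℤ (Fin r →₀ ℤ) T).quotKerEquivRange.finrank_eq] at h
    have hker : finrank ℤ (LinearMap.fst ℤ (Fin r →₀ ℤ) T).ker = 0 := by
      refine (finrank_eq_zero_iff_isTorsion (R := ℤ)
        (M := (LinearMap.fst ℤ (Fin r →₀ ℤ) T).ker)).mpr ?_
      rintro ⟨⟨v, t⟩, hv⟩
      obtain rfl : v = 0 := hv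
      refine ⟨⟨(Nat.card T : ℤ),
        mem_nonZeroDivisors_of_ne_zero (by exact_mod_cast Nat.card_pos.ne')⟩, ?_⟩
      ext1
      simp [Submonoid.smul_def]
    rw [LinearMap.range_eq_top.mpr LinearMap.fst_surjective, finrank_top, hker,
      finrank_finsupp_self, Fintype.card_fin, add_zero] at h
    rw [φ.toIntLinearEquiv.finrank_eq]
    exact h.symm
  have hi : (nsmulAddMonoidHom (α := G) k).range.index =
      ((nsmulAddMonoidHom (α := Fin r →₀ ℤ) k).range.prod
        (nsmulAddMonoidHom (α := T) k).range).index := by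
    rw [← AddSubgroup.index_map_equiv _ φ]
    congr 1
    ext ⟨v, t⟩
    simp only [AddSubgroup.mem_map, AddMonoidHom.mem_range, nsmulAddMonoidHom_apply,
      AddSubgroup.mem_prod]
    constructor
    · rintro ⟨_, ⟨g, rfl⟩, h⟩
      have h' : k • φ g = (v, t) := by rw [← map_nsmul]; exact h
      exact ⟨⟨_, congrArg Prod.fst h'⟩, ⟨_, congrArg Prod.snd h'⟩⟩
    · rintro ⟨⟨w, hw⟩, ⟨u, hu⟩⟩
      refine ⟨_, ⟨φ.symm (w, u), rfl⟩, ?_⟩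
      simp [map_nsmul, hw, hu]
  have hk : Nat.card (nsmulAddMonoidHom (α := G) k).ker =
      Nat.card (nsmulAddMonoidHom (α := T) k).ker := by
    have hmem (t : (nsmulAddMonoidHom (α := T) k).ker) :
        φ.symm (0, t.1) ∈ (nsmulAddMonoidHom (α := G) k).ker := by
      have ht : k • t.1 = 0 := t.2
      rw [AddMonoidHom.mem_ker, nsmulAddMonoidHom_apply, ← map_nsmul]
      simp [ht]
    refine (Nat.card_congr (Equiv.ofBijective (fun t ↦ ⟨φ.symm (0, t.1), hmem t⟩) ⟨?_, ?_⟩)).symm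
    · intro t u h
      exact Subtype.ext (congrArg Prod.snd (φ.symm.injective (Subtype.ext_iff.mp h)))
    · rintro ⟨g, hg⟩
      have hg' : k • φ g = 0 := by
        rw [← map_nsmul, show k • g = 0 from hg, map_zero]
      have h₁ : (φ g).1 = 0 := by
        have : k • (φ g).1 = 0 := congrArg Prod.fst hg'
        exact (smul_eq_zero.mp this).resolve_left (NeZero.ne k)
      refine ⟨⟨(φ g).2, congrArg Prod.snd hg'⟩, ?_⟩
      ext1
      rw [AddEquiv.symm_apply_eq, ← h₁]
  rw [hi, AddSubgroup.index_prod, index_range_nsmul_finsupp, index_range_nsmul_of_finite, hr, hk]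

end

/-! ### Explicit group law on x-coordinates -/

namespace congruentCurve

open WeierstrassCurve WeierstrassCurve.Affine

variable {n : ℕ}

lemma isElliptic (hn : n ≠ 0) : (congruentCurve n).IsElliptic := by
  have h : (congruentCurve n).Δ = 64 * (n : ℚ) ^ 6 := by
    simp only [congruentCurve, Δ, b₂, b₄, b₆, b₈]
    ring
  exact ⟨by rw [h, isUnit_iff_ne_zero]; positivity⟩

lemma equation_iff' {x y : ℚ} :
    (congruentCurve n).toAffine.Equation x y ↔ y ^ 2 = x * (x - n) * (x + n) := by
  rw [Affine.equation_iff]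
  simp only [congruentCurve]
  constructor <;> intro h <;> linear_combination h

lemma nonsingular_iff' (hn : n ≠ 0) {x y : ℚ} :
    (congruentCurve n).toAffine.Nonsingular x y ↔ y ^ 2 = x * (x - n) * (x + n) := by
  have := isElliptic hn
  rw [← Affine.equation_iff_nonsingular, equation_iff']

lemma negY_eq (x y : ℚ) : (congruentCurve n).toAffine.negY x y = -y := by
  simp [negY, congruentCurve]

lemma slope_of_X_eq {x y : ℚ} (hy : y ≠ 0) :
    (congruentCurve n).toAffine.slope x x y y = (3 * x ^ 2 - n ^ 2) / (2 * y) := by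
  rw [slope_of_Y_ne rfl (by rw [negY_eq]; intro h; apply hy; linarith), negY_eq]
  simp only [congruentCurve]
  congr 1 <;> ring

lemma addX_eq (x₁ x₂ ℓ : ℚ) : (congruentCurve n).toAffine.addX x₁ x₂ ℓ = ℓ ^ 2 - x₁ - x₂ := by
  simp [addX, congruentCurve]

lemma eval_addSubMap (a b c : ℚ) :
    (fun i ↦ (addSubMap (congruentCurve n) i).eval ![a, b, c]) =
      ![(a + n ^ 2 * c) ^ 2, 2 * b * (a - n ^ 2 * c), b ^ 2 - 4 * a * c] := by
  ext i
  fin_cases i <;> simp [addSubMap, congruentCurve, b₂, b₄, b₆, b₈] <;> ring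

/-- The symmetric square of the `x`-coordinate intertwines `(P, Q) ↦ (P + Q, P - Q)` with the map
`addSubMap`, up to scaling. -/
lemma exists_smul_sym2x_add_sub (hn : n ≠ 0) (P Q : (congruentCurve n).toAffine.Point) :
    ∃ t : ℚ, t ≠ 0 ∧ (fun i ↦ (addSubMap (congruentCurve n) i).eval (P.sym2x Q)) =
      t • (P + Q).sym2x (P - Q) := by
  -- The secant formula breaks down when Q = ±P. As `sym2x` ignores signs, both cases reduce to
  -- doubling.
  have key_self (P : (congruentCurve n).toAffine.Point) :
      ∃ t : ℚ, t ≠ 0 ∧ (fun i ↦ (addSubMap (congruentCurve n) i).eval (P.sym2x P)) =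
        t • (P + P).sym2x 0 := by
    match P with
    | 0 => exact ⟨1, one_ne_zero, by simp [eval_addSubMap]⟩
    | .some x y h =>
      have hxy := equation_iff'.mp h.1
      rw [Point.sym2x_some_some, eval_addSubMap]
      by_cases hy : y = 0
      · rw [Point.add_of_Y_eq rfl (by rw [negY_eq, hy, neg_zero]), Point.sym2x_zero_zero]
        have h0 : x * (x - n) * (x + n) = 0 := by rw [← hxy, hy]; ring
        refine ⟨(x * x + n ^ 2 * 1) ^ 2, ?_, ?_⟩
        · have : (n : ℚ) ≠ 0 := by exact_mod_cast hn
          have : 0 < (n : ℚ) ^ 2 := by positivity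
          have : 0 < x * x + n ^ 2 * 1 := by nlinarith [mul_self_nonneg x]
          positivity
        · ext i
          fin_cases i
          · simp
          · simp only [Fin.mk_one, Matrix.cons_val_one, Matrix.cons_val_zero, Pi.smul_apply,
              smul_eq_mul, mul_zero]
            linear_combination 4 * h0
          · simp; ring
      · have hne : y ≠ (congruentCurve n).toAffine.negY x y := by
          rw [negY_eq]; intro h; apply hy; linarith
        rw [Point.add_self_of_Y_ne hne, Point.sym2x_some_zero, addX_eq, slope_of_X_eq hy]
        refine ⟨4 * y ^ 2, by positivity, ?_⟩
        ext i
        fin_cases i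
        · simp
          field_simp
          linear_combination (32 * x) * hxy
        · simp
          linear_combination -4 * hxy
        · simp; ring
  match P, Q with
  | 0, Q =>
    match Q with
    | 0 => exact ⟨1, one_ne_zero, by simp [eval_addSubMap]⟩
    | .some x y h => exact ⟨1, one_ne_zero, by
      rw [zero_add, zero_sub, Point.sym2x_neg_right]
      simp [eval_addSubMap, sq, two_mul]⟩
  | .some x y h, 0 => exact ⟨1, one_ne_zero, by simp [eval_addSubMap, sq, two_mul]⟩
  | .some x₁ y₁ h₁, .some x₂ y₂ h₂ =>
    by_cases hx : x₁ = x₂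
    · rcases Point.X_eq_iff.mp hx with h | h
      · rw [h, sub_self]
        exact key_self _
      · rw [h, neg_add_cancel, Point.sym2x_neg_left, ← neg_add', Point.sym2x_neg_right,
          Point.sym2x_comm 0]
        exact key_self _
    · have e₁ := equation_iff'.mp h₁.1
      have e₂ := equation_iff'.mp h₂.1
      rw [sub_eq_add_neg, Point.neg_some, Point.add_of_X_ne hx, Point.add_of_X_ne hx,
        Point.sym2x_some_some, Point.sym2x_some_some, eval_addSubMap, addX_eq, addX_eq,
        slope_of_X_ne hx, slope_of_X_ne hx, negY_eq]
      have hx' := sub_ne_zero.mpr hx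
      refine ⟨(x₁ - x₂) ^ 2, by positivity, ?_⟩
      ext i
      fin_cases i
      · simp
        field_simp
        linear_combination (-(y₁ ^ 2 - y₂ ^ 2 + x₁ * (x₁ - n) * (x₁ + n) - x₂ * (x₂ - n) * (x₂ + n)))
          * (e₁ - e₂) + 2 * (x₁ + x₂) * (x₁ - x₂) ^ 2 * (e₁ + e₂)
      · simp
        field_simp
        linear_combination -2 * (e₁ + e₂)
      · simp; ring

end congruentCurve

/-! ### Naive height and finite generation -/

namespace congruentCurve

open WeierstrassCurve WeierstrassCurve.Affine Height

variable {n : ℕ}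

/-- The naive height of a rational point. -/
noncomputable def height (P : (congruentCurve n).toAffine.Point) : ℝ := logHeight P.xRep

/-- Northcott for ℚ bounds the number of x-coordinates, and each x-coordinate belongs to at most the
two points ±P. -/
lemma northcott_height : Northcott (height (n := n)) where
  finite_le B := by
    have hfin : {v : Fin 2 → ℚ | ∃ x, logHeight₁ x ≤ B ∧ v = ![x, 1]}.Finite := by
      refine ((Northcott.finite_le (h := logHeight₁ (K := ℚ)) B).image (fun x ↦ ![x, 1])).subset ?_
      rintro v ⟨x, hx, rfl⟩
      exact ⟨x, hx, rfl⟩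
    have := (hfin.insert ![1, 0]).preimage' (f := Point.xRep (W' := (congruentCurve n).toAffine)) ?_
    · refine this.subset ?_
      intro P hP
      match P with
      | 0 => left; simp
      | .some x y h =>
        right
        refine ⟨x, ?_, by simp⟩
        rw [logHeight₁_eq_logHeight]
        exact hP
    · intro v _
      by_cases hv : ∃ P : (congruentCurve n).toAffine.Point, P.xRep = v
      · obtain ⟨P, rfl⟩ := hv
        refine (Set.toFinite {P, -P}).subset ?_
        intro Q hQ
        exact Point.eq_or_eq_neg_of_xRep_eq_xRep hQ
      · refine Set.finite_empty.subset fun P hP ↦ hv ⟨P, hP⟩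

lemma abs_logHeight_sym2x_sub_le : ∃ C, ∀ P Q : (congruentCurve n).toAffine.Point,
    |logHeight (P.sym2x Q) - (height P + height Q)| ≤ C := by
  obtain ⟨C, hC⟩ := abs_logHeight_sym2_sub_le ℚ
  refine ⟨C, fun P Q ↦ ?_⟩
  have eta (v : Fin 2 → ℚ) : ![v 0, v 1] = v := by ext i; fin_cases i <;> rfl
  have := hC (a := P.xRep 0) (b := P.xRep 1) (c := Q.xRep 0) (d := Q.xRep 1)
    (by rw [eta]; exact P.xRep_ne_zero) (by rw [eta]; exact Q.xRep_ne_zero)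
  rwa [eta, eta] at this

/-- `addSubMap` doubles logarithmic heights up to O(1), and the height of `P.sym2x Q` is the sum of
the two heights up to O(1); projective scaling does not affect heights. -/
lemma approx_parallelogram_law (hn : n ≠ 0) : ∃ C, ∀ P Q : (congruentCurve n).toAffine.Point,
    |height (P + Q) + height (P - Q) - 2 * (height P + height Q)| ≤ C := by
  have := isElliptic hn
  obtain ⟨C₁, h₁⟩ := abs_logHeight_sym2x_sub_le (n := n)
  obtain ⟨C₂, h₂⟩ := abs_logHeight_addSubMap_sub_two_mul_logHeight_le (congruentCurve n)
  refine ⟨C₁ + C₂ + 2 * C₁, fun P Q ↦ ?_⟩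
  obtain ⟨t, ht, h⟩ := exists_smul_sym2x_add_sub hn P Q
  have h₃ := h₂ (P.sym2x Q)
  rw [h, logHeight_smul_eq_logHeight _ ht] at h₃
  have h₄ := h₁ (P + Q) (P - Q)
  have h₅ := h₁ P Q
  rw [abs_le] at *
  constructor <;> linarith

lemma fg_of_finiteIndex (hn : n ≠ 0)
    (h : (nsmulAddMonoidHom (α := (congruentCurve n).toAffine.Point) 2).range.FiniteIndex) :
    AddGroup.FG (congruentCurve n).toAffine.Point := by
  have := northcott_height (n := n)
  obtain ⟨C, hC⟩ := approx_parallelogram_law hn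
  exact AddCommGroup.fg_of_descent' (h := height) h (fun P ↦ logHeight_nonneg _) hC

end congruentCurve

/-! ### Square classes of rational numbers -/

/-- A positive rational number with even valuation at all primes is a square. -/
lemma Rat.isSquare_of_even_padicValRat {q : ℚ} (hq : 0 < q)
    (h : ∀ l : ℕ, l.Prime → Even (padicValRat l q)) : IsSquare q := by
  -- Numerator times denominator is a natural number in the square class of q.
  set m : ℕ := q.num.natAbs * q.den
  have hm : (m : ℚ) = q * q.den ^ 2 := by
    have : (q.num.natAbs : ℚ) = q.num := by
      rw [Nat.cast_natAbs, abs_of_nonneg (Rat.num_nonneg.mpr hq.le)]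
    rw [Nat.cast_mul, this, ← Rat.mul_den_eq_num q]
    ring
  have hd : (q.den : ℚ) ≠ 0 := by exact_mod_cast q.den_ne_zero
  have hm0 : m ≠ 0 := by
    intro h0
    rw [h0] at hm
    exact (mul_ne_zero hq.ne' (pow_ne_zero 2 hd)) (by rw [← hm]; simp)
  have hev (l : ℕ) : Even (m.factorization l) := by
    by_cases hl : l.Prime
    · have := Fact.mk hl
      rw [Nat.factorization_def _ hl, ← Int.even_coe_nat, ← padicValRat.of_nat, hm,
        padicValRat.mul hq.ne' (pow_ne_zero 2 hd), padicValRat.pow]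
      exact (h l hl).add (by simp)
    · simp [Nat.factorization_eq_zero_of_not_prime m hl]
  have hsq : m = (m.factorization.prod fun l e ↦ l ^ (e / 2)) ^ 2 := by
    conv_lhs => rw [← Nat.prod_factorization_pow_eq_self hm0]
    rw [Finsupp.prod, Finsupp.prod, ← Finset.prod_pow]
    refine Finset.prod_congr rfl fun l _ ↦ ?_
    rw [← pow_mul, Nat.div_mul_cancel (hev l).two_dvd]
  set s := m.factorization.prod fun l e ↦ l ^ (e / 2)
  refine ⟨s / q.den, ?_⟩
  have : (m : ℚ) = s ^ 2 := by exact_mod_cast hsq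
  field_simp
  rw [← hm, this]

/-- If `abc` is a nonzero square and the differences `b - a`, `c - a` are `l`-adic units, then
`a` has even valuation at `l`. -/
lemma even_padicValRat_of_mul_eq_sq {l : ℕ} [Fact l.Prime] {a b c y : ℚ} (ha : a ≠ 0) (hb : b ≠ 0)
    (hc : c ≠ 0) (hy : y ^ 2 = a * b * c) (hab : b - a ≠ 0) (hac : c - a ≠ 0)
    (hab' : padicValRat l (b - a) = 0) (hac' : padicValRat l (c - a) = 0) :
    Even (padicValRat l a) := by
  have key {b : ℚ} (hb : b ≠ 0) (hab : b - a ≠ 0) (h : padicValRat l (b - a) = 0)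
      (h0 : padicValRat l a ≠ 0) : padicValRat l b = min (padicValRat l a) 0 := by
    have := padicValRat.add_eq_min (p := l) (q := a) (r := b - a) (by simpa using hb) ha hab
      (by rwa [h])
    rwa [add_sub_cancel, h] at this
  by_cases h0 : padicValRat l a = 0
  · simp [h0]
  -- When v(a) ≠ 0, both b and c have valuation min(v(a), 0), so 2v(y) = v(a) + 2 min(v(a), 0).
  · have hv : padicValRat l (y ^ 2) = padicValRat l a + padicValRat l b + padicValRat l c := by
      rw [hy, padicValRat.mul (mul_ne_zero ha hb) hc, padicValRat.mul ha hb]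
    rw [padicValRat.pow, key hb hab hab' h0, key hc hac hac' h0] at hv
    push_cast at hv
    rcases min_cases (padicValRat l a) 0 with h | h
    · rw [h.1] at hv
      exact ⟨padicValRat l y - padicValRat l a, by linarith⟩
    · rw [h.1] at hv
      exact ⟨padicValRat l y, by linarith⟩

/-- A map on the rationals that is additive on products of nonzero elements. -/
structure IsLogLike (χ : ℚ → ZMod 2) : Prop where
  map_mul {a b : ℚ} (ha : a ≠ 0) (hb : b ≠ 0) : χ (a * b) = χ a + χ b

namespace IsLogLike

lemma map_sq {χ : ℚ → ZMod 2} (hχ : IsLogLike χ) {a : ℚ} (ha : a ≠ 0) : χ (a ^ 2) = 0 := by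
  rw [sq, hχ.map_mul ha ha, CharTwo.add_self_eq_zero]

lemma map_mul_sq {χ : ℚ → ZMod 2} (hχ : IsLogLike χ) {a b : ℚ} (ha : a ≠ 0) (hb : b ≠ 0) :
    χ (a * b ^ 2) = χ a := by
  rw [hχ.map_mul ha (pow_ne_zero 2 hb), hχ.map_sq hb, add_zero]

end IsLogLike

/-- The parity of the `l`-adic valuation. -/
def valuationParity (l : ℕ) (q : ℚ) : ZMod 2 := (padicValRat l q : ℤ)

lemma isLogLike_valuationParity (l : ℕ) [Fact l.Prime] : IsLogLike (valuationParity l) where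
  map_mul ha hb := by rw [valuationParity, padicValRat.mul ha hb]; simp [valuationParity]

/-- The sign of a rational number as an element of `ZMod 2`. -/
def signParity (q : ℚ) : ZMod 2 := if 0 ≤ q then 0 else 1

lemma isLogLike_signParity : IsLogLike signParity where
  map_mul {a b} ha hb := by
    rcases ha.lt_or_gt with ha | ha <;> rcases hb.lt_or_gt with hb | hb
    · simp [signParity, (mul_pos_of_neg_of_neg ha hb).le, ha.not_ge, hb.not_ge]; decide
    · simp [signParity, (mul_neg_of_neg_of_pos ha hb).not_ge, ha.not_ge, hb.le]
    · simp [signParity, (mul_neg_of_pos_of_neg ha hb).not_ge, ha.le, hb.not_ge]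
    · simp [signParity, (mul_pos ha hb).le, ha.le, hb.le]

/-! ### Descent homomorphisms attached to the 2-torsion points -/

namespace congruentCurve

open WeierstrassCurve WeierstrassCurve.Affine

variable {n : ℕ}

/-- A representative of the descent class of `P` at the two-torsion point `(e, 0)`. -/
noncomputable def descentRep (e : ℚ) : (congruentCurve n).toAffine.Point → ℚ
  | 0 => 1
  -- At x = e the value is the derivative of the cubic at its root e, that is, the product of the
  -- differences from e to the other two roots.
  | .some x _ _ => if x = e then 3 * e ^ 2 - n ^ 2 else x - e

lemma descentRep_zero (e : ℚ) : descentRep e (0 : (congruentCurve n).toAffine.Point) = 1 := rfl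

lemma descentRep_some (e : ℚ) {x y : ℚ} (h : (congruentCurve n).toAffine.Nonsingular x y) :
    descentRep e (Point.some x y h) = if x = e then 3 * e ^ 2 - n ^ 2 else x - e := rfl

lemma descentRep_ne_zero {e : ℚ} (hn : n ≠ 0) (he : e * (e - n) * (e + n) = 0)
    (P : (congruentCurve n).toAffine.Point) : descentRep e P ≠ 0 := by
  have hn' : (n : ℚ) ≠ 0 := by exact_mod_cast hn
  match P with
  | 0 => exact one_ne_zero
  | .some x y h =>
    rw [descentRep_some]
    split_ifs with hx
    · intro h0
      apply hn'
      have : (n : ℚ) ^ 2 * n ^ 2 = 0 := by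
        linear_combination (3 / 2 * e ^ 2 - (n : ℚ) ^ 2) * h0 - 9 / 2 * e * he
      simpa using this
    · exact sub_ne_zero.mpr hx

/-- The cubic minus the square of the line through the three points has roots x₁, x₂, x₃. Here L is
the value of the line at e, ℓ its slope and f the derivative of the cubic at e; `h₁` and `h₂` are
this factorisation and its derivative at e. If L = 0, some xᵢ is e and f is the product of the other
two differences, so the product is f². -/
lemma isSquare_descentRep {e x₁ x₂ x₃ L f ℓ : ℚ} (hf : f ≠ 0)
    (h₁ : L ^ 2 = (x₁ - e) * (x₂ - e) * (x₃ - e))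
    (h₂ : 2 * L * ℓ - f = -((e - x₁) * (e - x₂) + (e - x₁) * (e - x₃) + (e - x₂) * (e - x₃))) :
    IsSquare ((if x₁ = e then f else x₁ - e) * (if x₂ = e then f else x₂ - e) *
      (if x₃ = e then f else x₃ - e)) := by
  by_cases hL : L = 0
  · rw [hL] at h₁ h₂
    have h₀ : x₁ = e ∨ x₂ = e ∨ x₃ = e := by
      have : (x₁ - e) * (x₂ - e) * (x₃ - e) = 0 := by rw [← h₁]; ring
      simpa [sub_eq_zero, or_assoc] using this
    refine ⟨f, ?_⟩
    rcases h₀ with rfl | rfl | rfl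
    · have hf' : f = (x₂ - x₁) * (x₃ - x₁) := by linear_combination -h₂
      have h₂ : x₂ ≠ x₁ := by rintro rfl; simp at hf'; exact hf hf'
      have h₃ : x₃ ≠ x₁ := by rintro rfl; simp at hf'; exact hf hf'
      rw [if_pos rfl, if_neg h₂, if_neg h₃, mul_assoc, ← hf']
    · have hf' : f = (x₁ - x₂) * (x₃ - x₂) := by linear_combination -h₂
      have h₁ : x₁ ≠ x₂ := by rintro rfl; simp at hf'; exact hf hf'
      have h₃ : x₃ ≠ x₂ := by rintro rfl; simp at hf'; exact hf hf'
      rw [if_pos rfl, if_neg h₁, if_neg h₃, mul_right_comm, ← hf']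
    · have hf' : f = (x₁ - x₃) * (x₂ - x₃) := by linear_combination -h₂
      have h₁ : x₁ ≠ x₃ := by rintro rfl; simp at hf'; exact hf hf'
      have h₂ : x₂ ≠ x₃ := by rintro rfl; simp at hf'; exact hf hf'
      rw [if_pos rfl, if_neg h₁, if_neg h₂, ← hf']
  · have h₀ : (x₁ - e) * (x₂ - e) * (x₃ - e) ≠ 0 := h₁ ▸ pow_ne_zero 2 hL
    simp only [ne_eq, mul_eq_zero, sub_eq_zero, not_or] at h₀
    rw [if_neg h₀.1.1, if_neg h₀.1.2, if_neg h₀.2, ← h₁]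
    exact ⟨L, sq L⟩

lemma isSquare_descentRep_add {e : ℚ} (hn : n ≠ 0) (he : e * (e - n) * (e + n) = 0)
    (P Q : (congruentCurve n).toAffine.Point) :
    IsSquare (descentRep e P * descentRep e Q * descentRep e (P + Q)) := by
  match P, Q with
  | 0, Q => rw [zero_add, descentRep_zero, one_mul]; exact ⟨_, rfl⟩
  | .some x y h, 0 => rw [add_zero, descentRep_zero, mul_one]; exact ⟨_, rfl⟩
  | .some x₁ y₁ h₁, .some x₂ y₂ h₂ =>
    by_cases hxy : x₁ = x₂ ∧ y₁ = (congruentCurve n).toAffine.negY x₂ y₂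
    · rw [Point.add_of_Y_eq hxy.1 hxy.2, descentRep_zero, mul_one, descentRep_some,
        descentRep_some, hxy.1]
      exact ⟨_, rfl⟩
    · have hf := descentRep_ne_zero hn he (Point.some e 0 ((nonsingular_iff' hn).mpr (by rw [he]; ring)))
      rw [descentRep_some, if_pos rfl] at hf
      rw [Point.add_some hxy]
      simp only [descentRep_some]
      have e₁ := congrArg (Polynomial.eval e) (addPolynomial_slope h₁.1 h₂.1 hxy)
      have e₂ := congrArg (Polynomial.eval e) (derivative_addPolynomial_slope h₁.1 h₂.1 hxy)
      set ℓ := (congruentCurve n).toAffine.slope x₁ x₂ y₁ y₂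
      set x₃ := (congruentCurve n).toAffine.addX x₁ x₂ ℓ
      rw [addPolynomial_eq, Cubic.toPoly] at e₁ e₂
      simp only [Polynomial.derivative_neg, Polynomial.derivative_add, Polynomial.derivative_C_mul,
        Polynomial.derivative_X_pow, Polynomial.derivative_X, Polynomial.derivative_C] at e₂
      simp [congruentCurve] at e₁ e₂
      refine isSquare_descentRep (L := ℓ * (e - x₁) + y₁) (ℓ := ℓ) hf ?_ ?_
      · linear_combination e₁ + he
      · linear_combination e₂

/-- The homomorphism to `ZMod 2` induced by a character of the square classes. -/
noncomputable def descentHom {e : ℚ} (hn : n ≠ 0) (he : e * (e - n) * (e + n) = 0)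
    {χ : ℚ → ZMod 2} (hχ : IsLogLike χ) : (congruentCurve n).toAffine.Point →+ ZMod 2 :=
  AddMonoidHom.mk' (fun P ↦ χ (descentRep e P)) fun P Q ↦ by
    obtain ⟨s, hs⟩ := isSquare_descentRep_add hn he P Q
    have hP := descentRep_ne_zero hn he P
    have hQ := descentRep_ne_zero hn he Q
    have hR := descentRep_ne_zero hn he (P + Q)
    have hs0 : s ≠ 0 := by
      rintro rfl
      exact mul_ne_zero (mul_ne_zero hP hQ) hR (by rw [hs, zero_mul])
    have := congrArg χ hs
    rw [hχ.map_mul (mul_ne_zero hP hQ) hR, hχ.map_mul hP hQ, hχ.map_mul hs0 hs0,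
      CharTwo.add_self_eq_zero] at this
    exact (CharTwo.add_eq_zero.mp this).symm

end congruentCurve

/-! ### Kernel of the 2-descent and rational 2-torsion -/

namespace congruentCurve

open WeierstrassCurve WeierstrassCurve.Affine

variable {n p : ℕ}

/-- A point is divisible by two if `x`, `x - n` and `x + n` are all squares. -/
lemma exists_two_nsmul_eq (hn : n ≠ 0) {x y : ℚ} (h : (congruentCurve n).toAffine.Nonsingular x y)
    (h₀ : IsSquare x) (h₁ : IsSquare (x - n)) (h₂ : IsSquare (x + n)) :
    ∃ Q : (congruentCurve n).toAffine.Point, 2 • Q = Point.some x y h := by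
  have hn' : (n : ℚ) ≠ 0 := by exact_mod_cast hn
  obtain ⟨r, hr⟩ := h₀
  obtain ⟨s, hs⟩ := h₁
  obtain ⟨t, ht⟩ := h₂
  have hxy := equation_iff'.mp h.1
  have hrs : (r + s) ≠ 0 := fun h0 ↦ hn' (by linear_combination hr - hs + (r - s) * h0)
  have hrt : (r + t) ≠ 0 := fun h0 ↦ hn' (by linear_combination ht - hr - (r - t) * h0)
  have hst : (s + t) ≠ 0 := fun h0 ↦ hn' (by linear_combination (ht - hs - (s - t) * h0) / 2)
  have hn₁ : (n : ℚ) = r ^ 2 - s ^ 2 := by linear_combination hr - hs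
  have hn₂ : (n : ℚ) = t ^ 2 - r ^ 2 := by linear_combination ht - hr
  -- Classical halving formula: X = (r + s)(r + t), and X ∓ n factor likewise. The tangent at (X, Y)
  -- has slope r + s + t, so doubling gives (r + s + t)² - 2X = s² + t² - r² = r² = x.
  set X := r ^ 2 + r * s + r * t + s * t with hX
  set Y := (r + s) * (r + t) * (s + t) with hY
  have hY0 : Y ≠ 0 := mul_ne_zero (mul_ne_zero hrs hrt) hst
  have e₁ : X - n = (s + r) * (s + t) := by linear_combination hX - hn₁
  have e₂ : X + n = (t + r) * (t + s) := by linear_combination hX + hn₂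
  have hXY : (congruentCurve n).toAffine.Nonsingular X Y := by
    rw [nonsingular_iff' hn]
    rw [e₁, e₂, hX, hY]
    ring
  have hne : Y ≠ (congruentCurve n).toAffine.negY X Y := by
    rw [negY_eq]; intro h; apply hY0; linarith
  have hdbl : (Point.some X Y hXY + Point.some X Y hXY).xRep = (Point.some x y h).xRep := by
    rw [Point.add_self_of_Y_ne hne, Point.xRep_some, Point.xRep_some, addX_eq, slope_of_X_eq hY0]
    congr 1
    have e₃ : (3 * X ^ 2 - (n : ℚ) ^ 2) = 2 * Y * (r + s + t) := by
      have : 3 * X ^ 2 - (n : ℚ) ^ 2 = X * (X - n) + X * (X + n) + (X - n) * (X + n) := by ring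
      rw [this, e₁, e₂, hX, hY]
      ring
    rw [e₃, mul_div_cancel_left₀ _ (mul_ne_zero two_ne_zero hY0), hX, hr]
    linear_combination hn₁ - hn₂
  rcases Point.eq_or_eq_neg_of_xRep_eq_xRep hdbl with hQ | hQ
  · exact ⟨_, (two_nsmul _).trans hQ⟩
  · refine ⟨-Point.some X Y hXY, ?_⟩
    rw [two_nsmul, ← neg_add, hQ, neg_neg]

/-- The complete two-descent homomorphism for `y² = x³ - p²x` with `p` prime: the square class of
`x` is recorded by its sign and its valuation at `p`, that of `x - p` by its valuations at `2`
and `p`. -/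
noncomputable def twoDescent (p : ℕ) [Fact p.Prime] :
    (congruentCurve p).toAffine.Point →+ ZMod 2 × ZMod 2 × ZMod 2 × ZMod 2 :=
  have hp : p ≠ 0 := (Fact.out : p.Prime).ne_zero
  have h₀ : (0 : ℚ) * (0 - p) * (0 + p) = 0 := by ring
  have h₁ : (p : ℚ) * (p - p) * (p + p) = 0 := by ring
  (descentHom hp h₀ isLogLike_signParity).prod <|
    (descentHom hp h₀ (isLogLike_valuationParity p)).prod <|
      (descentHom hp h₁ (isLogLike_valuationParity 2)).prod
        (descentHom hp h₁ (isLogLike_valuationParity p))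

variable [Fact p.Prime]

lemma twoDescent_apply (P : (congruentCurve p).toAffine.Point) :
    twoDescent p P = (signParity (descentRep 0 P), valuationParity p (descentRep 0 P),
      valuationParity 2 (descentRep p P), valuationParity p (descentRep p P)) := rfl

lemma valuationParity_eq_zero_iff {l : ℕ} {q : ℚ} :
    valuationParity l q = 0 ↔ Even (padicValRat l q) := by
  rw [valuationParity, ZMod.intCast_eq_zero_iff_even]

lemma signParity_eq_zero_iff {q : ℚ} : signParity q = 0 ↔ 0 ≤ q := by
  rw [signParity]
  split_ifs with h <;> simp [h]

lemma padicValRat_prime_of_ne {l p : ℕ} [Fact l.Prime] [Fact p.Prime] (h : l ≠ p) :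
    padicValRat l p = 0 := by
  rw [padicValRat.of_nat, padicValNat_primes h, Nat.cast_zero]

/-- x differs from x ∓ p by units away from p, and x - p differs from x and x + p by units away from
2 and p. Elsewhere valuations are therefore even automatically, and x + p is a square once x and x -
p are. -/
lemma ker_twoDescent :
    (twoDescent p).ker = (nsmulAddMonoidHom (α := (congruentCurve p).toAffine.Point) 2).range := by
  have hp : p ≠ 0 := (Fact.out : p.Prime).ne_zero
  have hp' : (0 : ℚ) < p := by exact_mod_cast Nat.pos_of_ne_zero hp
  ext P
  constructor
  · intro hP
    rw [AddMonoidHom.mem_ker, twoDescent_apply] at hP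
    simp only [Prod.mk_eq_zero, signParity_eq_zero_iff, valuationParity_eq_zero_iff] at hP
    obtain ⟨h₁, h₂, h₃, h₄⟩ := hP
    match P with
    | 0 => exact zero_mem _
    | .some x y h =>
      rw [AddMonoidHom.mem_range]
      simp only [descentRep_some] at h₁ h₂ h₃ h₄
      have hxy := equation_iff'.mp h.1
      -- The classes at 0 exclude two torsion points: x = 0 gives -p² < 0, and x = p gives odd
      -- valuation at p.
      have hx0 : x ≠ 0 := by
        rintro rfl
        rw [if_pos rfl] at h₁
        nlinarith
      rw [if_neg hx0, sub_zero] at h₁ h₂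
      have hx : 0 < x := h₁.lt_of_ne' hx0
      have hxp : x ≠ p := by
        rintro rfl
        rw [padicValRat.self (Fact.out : p.Prime).one_lt] at h₂
        exact absurd h₂ (by decide)
      rw [if_neg hxp] at h₃ h₄
      have hxn : 0 < x - p := by
        refine lt_of_le_of_ne ?_ (sub_ne_zero.mpr hxp).symm
        have : 0 ≤ x * (x + p) * (x - p) := by nlinarith [sq_nonneg y]
        exact nonneg_of_mul_nonneg_right this (by positivity)
      have hxp' : 0 < x + p := by positivity
      have s₀ : IsSquare x := by
        refine Rat.isSquare_of_even_padicValRat hx fun l hl ↦ ?_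
        have := Fact.mk hl
        by_cases hlp : l = p
        · rwa [hlp]
        · refine even_padicValRat_of_mul_eq_sq hx.ne' hxn.ne' hxp'.ne' hxy ?_ ?_ ?_ ?_
          · simpa using hp
          · simpa using hp
          · rw [sub_sub_cancel_left, padicValRat.neg, padicValRat_prime_of_ne hlp]
          · rw [add_sub_cancel_left, padicValRat_prime_of_ne hlp]
      have s₁ : IsSquare (x - p) := by
        refine Rat.isSquare_of_even_padicValRat hxn fun l hl ↦ ?_
        have := Fact.mk hl
        by_cases hlp : l = p
        · rwa [hlp]
        by_cases hl2 : l = 2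
        · rwa [hl2]
        have e₁ : x - (x - p) = p := by ring
        have e₂ : x + p - (x - p) = (2 : ℕ) * p := by push_cast; ring
        refine even_padicValRat_of_mul_eq_sq hxn.ne' hx.ne' hxp'.ne' (y := y) ?_ ?_ ?_ ?_ ?_
        · rw [hxy]; ring
        · rw [e₁]; exact hp'.ne'
        · rw [e₂]; positivity
        · rw [e₁, padicValRat_prime_of_ne hlp]
        · rw [e₂, padicValRat.mul (by norm_num) hp'.ne', padicValRat_prime_of_ne hlp,
            padicValRat_prime_of_ne hl2, add_zero]
      have s₂ : IsSquare (x + p) := by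
        obtain ⟨r, hr⟩ := s₀.mul s₁
        have hr0 : r ≠ 0 := by
          rintro rfl
          exact (mul_pos hx hxn).ne' (by rw [hr, zero_mul])
        refine ⟨y / r, ?_⟩
        field_simp
        rw [hxy, hr]
        ring
      exact exists_two_nsmul_eq hp h s₀ s₁ s₂
  · rintro ⟨Q, rfl⟩
    rw [AddMonoidHom.mem_ker, nsmulAddMonoidHom_apply, map_nsmul]
    generalize twoDescent p Q = v
    revert v
    decide

/-- The rational two-torsion of `y² = x³ - n²x` has order four. -/
lemma card_ker_two_nsmul (hn : n ≠ 0) :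
    Nat.card (nsmulAddMonoidHom (α := (congruentCurve n).toAffine.Point) 2).ker = 4 := by
  have hn' : (n : ℚ) ≠ 0 := by exact_mod_cast hn
  have h (e : ℚ) (he : e * (e - n) * (e + n) = 0) :
      (congruentCurve n).toAffine.Nonsingular e 0 := by
    rw [nonsingular_iff' hn, he]; ring
  have h₀ := h 0 (by ring)
  have h₁ := h n (by ring)
  have h₂ := h (-n) (by ring)
  have hset : ((nsmulAddMonoidHom (α := (congruentCurve n).toAffine.Point) 2).ker :
      Set (congruentCurve n).toAffine.Point) =
      (({0, Point.some _ _ h₀, Point.some _ _ h₁, Point.some _ _ h₂} :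
        Finset (congruentCurve n).toAffine.Point) : Set (congruentCurve n).toAffine.Point) := by
    ext P
    simp only [SetLike.mem_coe, AddMonoidHom.mem_ker, nsmulAddMonoidHom_apply, two_nsmul,
      Finset.coe_insert, Finset.coe_singleton, Set.mem_insert_iff, Set.mem_singleton_iff]
    match P with
    | 0 => simp
    | .some x y hxy =>
      rw [add_eq_zero_iff_eq_neg, Point.neg_some]
      simp only [Point.some.injEq, Point.some_ne_zero, negY_eq, true_and, false_or]
      have hy : y = -y ↔ y = 0 := ⟨fun h ↦ by linarith, fun h ↦ by rw [h, neg_zero]⟩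
      rw [hy, ← or_and_right, ← or_and_right]
      refine ⟨fun hy0 ↦ ⟨?_, hy0⟩, fun h ↦ h.2⟩
      have := equation_iff'.mp hxy.1
      rw [hy0] at this
      have : x * (x - n) * (x + n) = 0 := by rw [← this]; ring
      simpa [sub_eq_zero, add_eq_zero_iff_eq_neg, or_assoc] using this
  have hneg : (n : ℚ) ≠ -n := fun h ↦ hn' (by linarith)
  change Nat.card ((nsmulAddMonoidHom (α := (congruentCurve n).toAffine.Point) 2).ker :
    Set (congruentCurve n).toAffine.Point) = 4
  rw [hset, Nat.card_coe_set_eq, Set.ncard_coe_finset]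
  have hz {x y : ℚ} (hxy : (congruentCurve n).toAffine.Nonsingular x y) :
      0 ≠ Point.some x y hxy := (Point.some_ne_zero hxy).symm
  rw [Finset.card_insert_of_notMem, Finset.card_insert_of_notMem, Finset.card_insert_of_notMem,
    Finset.card_singleton]
  · simpa using hneg
  · simp [hn', eq_comm]
  · simp [hz]

end congruentCurve

/-! ### Points realising the descent classes, and the rank -/

namespace congruentCurve

open WeierstrassCurve WeierstrassCurve.Affine

variable {p : ℕ} [Fact p.Prime]

lemma prime_ne_sq {p : ℕ} (hp : p.Prime) {m : ℤ} : (p : ℤ) ≠ m ^ 2 := fun h ↦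
  (Nat.prime_iff_prime_int.mp hp).not_isSquare ⟨m, by rw [h, sq]⟩

/-- If `x` is a nonzero square and `x - p` is `d` times a nonzero square, then the descent class is
`(1, d)`. -/
lemma twoDescent_some_of_sq {x y d u v : ℚ} (h : (congruentCurve p).toAffine.Nonsingular x y)
    (hu : u ≠ 0) (hv : v ≠ 0) (hd : d ≠ 0) (hx : x = u ^ 2) (hxp : x - p = d * v ^ 2) :
    twoDescent p (Point.some x y h) = (0, 0, valuationParity 2 d, valuationParity p d) := by
  have hx0 : x ≠ 0 := hx ▸ pow_ne_zero 2 hu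
  have hxp0 : x ≠ p := sub_ne_zero.mp (hxp ▸ mul_ne_zero hd (pow_ne_zero 2 hv))
  rw [twoDescent_apply, descentRep_some, descentRep_some, if_neg hx0, if_neg hxp0, sub_zero, hxp,
    hx, (isLogLike_valuationParity p).map_sq hu, isLogLike_signParity.map_sq hu,
    (isLogLike_valuationParity p).map_mul_sq hd hv, (isLogLike_valuationParity 2).map_mul_sq hd hv]

lemma valuationParity_prime_self (l : ℕ) [hl : Fact l.Prime] : valuationParity l l = 1 := by
  rw [valuationParity, padicValRat.self hl.out.one_lt, Int.cast_one]

lemma valuationParity_prime_of_ne {l p : ℕ} [Fact l.Prime] [Fact p.Prime] (h : l ≠ p) :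
    valuationParity l p = 0 := by
  rw [valuationParity, padicValRat_prime_of_ne h, Int.cast_zero]

/-- A representation `p = a + b` with `a - b` and `a² + b²` squares yields a point of descent class
`(1, 2)`. -/
lemma exists_twoDescent_eq_of_add (hp2 : p ≠ 2) {a b : ℕ} (hab : p = a + b)
    (h₁ : IsSquare ((a : ℤ) - (b : ℤ))) (h₂ : IsSquare ((a : ℤ) ^ 2 + (b : ℤ) ^ 2)) :
    ∃ P, twoDescent p P = (0, 0, 1, 0) := by
  have hp : p.Prime := Fact.out
  obtain ⟨s, hs⟩ := h₁
  obtain ⟨t, ht⟩ := h₂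
  have hs0 : s ≠ 0 := by
    rintro rfl
    have : p = 2 * b := by omega
    have := (Nat.prime_dvd_prime_iff_eq Nat.prime_two hp).mp ⟨b, this⟩
    exact hp2 this.symm
  have hb0 : b ≠ 0 := by
    rintro rfl
    exact prime_ne_sq hp (m := s) (by rw [sq, ← hs, hab]; simp)
  have ht0 : t ≠ 0 := by
    rintro rfl
    have : (0 : ℤ) < b := by exact_mod_cast Nat.pos_of_ne_zero hb0
    nlinarith [sq_nonneg (a : ℤ)]
  have hsq : (s : ℚ) ≠ 0 := by exact_mod_cast hs0
  have htq : (t : ℚ) ≠ 0 := by exact_mod_cast ht0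
  have hbq : (b : ℚ) ≠ 0 := by exact_mod_cast hb0
  have hs' : (a : ℚ) - b = s ^ 2 := by rw [sq]; exact_mod_cast hs
  have ht' : (a : ℚ) ^ 2 + b ^ 2 = t ^ 2 := by rw [sq (t : ℚ)]; exact_mod_cast ht
  have hp' : (p : ℚ) = a + b := by exact_mod_cast hab
  -- The choice x = (t/s)² works because p s² = (a + b)(a - b), so t² ∓ p s² is 2b² or 2a².
  have e₁ : ((t : ℚ) / s) ^ 2 - p = 2 * (b / s) ^ 2 := by
    field_simp
    rw [← hs', ← ht', hp']
    ring
  have e₂ : ((t : ℚ) / s) ^ 2 + p = 2 * (a / s) ^ 2 := by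
    field_simp
    rw [← hs', ← ht', hp']
    ring
  have h : (congruentCurve p).toAffine.Nonsingular (((t : ℚ) / s) ^ 2)
      (2 * (t / s) * (a / s) * (b / s)) := by
    rw [nonsingular_iff' hp.ne_zero, e₁, e₂]
    ring
  refine ⟨Point.some _ _ h, ?_⟩
  rw [twoDescent_some_of_sq h (div_ne_zero htq hsq) (div_ne_zero hbq hsq) two_ne_zero rfl e₁]
  have := valuationParity_prime_self 2
  have := valuationParity_prime_of_ne (l := p) (p := 2) hp2
  simp_all

/-- A representation `p = a² + b²` with `(a + 2b)² + b²` a square yields a point of descent class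
`(1, p)`. -/
lemma exists_twoDescent_eq_of_sq_add_sq (hp2 : p ≠ 2) {a b : ℤ} (hab : (p : ℤ) = a ^ 2 + b ^ 2)
    (h : IsSquare ((a + 2 * b) ^ 2 + b ^ 2)) : ∃ P, twoDescent p P = (0, 0, 0, 1) := by
  have hp : p.Prime := Fact.out
  have hpq : (p : ℚ) ≠ 0 := by exact_mod_cast hp.ne_zero
  obtain ⟨c, hc⟩ := h
  have hb0 : b ≠ 0 := by
    rintro rfl
    exact prime_ne_sq hp (m := a) (by rw [hab]; ring)
  have hα0 : a + b ≠ 0 := by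
    intro h0
    have : (p : ℤ) = 2 * b ^ 2 := by
      rw [hab, eq_neg_of_add_eq_zero_left h0]; ring
    have := (Nat.prime_dvd_prime_iff_eq Nat.prime_two hp).mp
      (Int.natCast_dvd_natCast.mp ⟨b ^ 2, this⟩)
    exact hp2 this.symm
  have hc0 : c ≠ 0 := by
    rintro rfl
    have : 0 < b ^ 2 := by positivity
    nlinarith [sq_nonneg (a + 2 * b)]
  -- Irrationality of √2; this keeps x ≠ p for the point built below.
  have hY0 : (a + b) ^ 2 - 2 * b ^ 2 ≠ 0 := by
    intro h0
    have h2 : ((2 : ℕ) : ℚ) = ((a + b) / b) ^ 2 := by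
      have hbq : (b : ℚ) ≠ 0 := by exact_mod_cast hb0
      field_simp
      exact_mod_cast (sub_eq_zero.mp h0).symm
    have := congrArg (padicValRat 2) h2
    rw [padicValRat.pow, padicValRat.self one_lt_two] at this
    push_cast at this
    omega
  have hbq : (b : ℚ) ≠ 0 := by exact_mod_cast hb0
  have hαq : (a : ℚ) + b ≠ 0 := by exact_mod_cast hα0
  have hcq : (c : ℚ) ≠ 0 := by exact_mod_cast hc0
  have hYq : ((a : ℚ) + b) ^ 2 - 2 * b ^ 2 ≠ 0 := by exact_mod_cast hY0
  have hp' : (p : ℚ) = a ^ 2 + b ^ 2 := by exact_mod_cast hab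
  have hc' : ((a : ℚ) + 2 * b) ^ 2 + b ^ 2 = c ^ 2 := by rw [sq (c : ℚ)]; exact_mod_cast hc
  set w : ℚ := 2 * (a + b) * b with hw
  have hw0 : w ≠ 0 := mul_ne_zero (mul_ne_zero two_ne_zero hαq) hbq
  -- Sophie Germain's identity with α = a + b: p = α² - 2αb + 2b² and c² = α² + 2αb + 2b².
  -- Subtracting or adding w² = 4α²b² turns α⁴ + 4b⁴ into (α² ∓ 2b²)², which suggests x = (pc/w)².
  have key : (p : ℚ) * c ^ 2 = (a + b) ^ 4 + 4 * b ^ 4 := by rw [hp', ← hc']; ring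
  have e₁ : (p * c / w) ^ 2 - p = p * ((((a : ℚ) + b) ^ 2 - 2 * b ^ 2) / w) ^ 2 := by
    field_simp
    rw [key, hw]
    ring
  have e₂ : (p * c / w) ^ 2 + p = p * ((((a : ℚ) + b) ^ 2 + 2 * b ^ 2) / w) ^ 2 := by
    field_simp
    rw [key, hw]
    ring
  have hns : (congruentCurve p).toAffine.Nonsingular ((p * c / w) ^ 2)
      (p * (p * c / w) * ((((a : ℚ) + b) ^ 2 - 2 * b ^ 2) / w) *
        ((((a : ℚ) + b) ^ 2 + 2 * b ^ 2) / w)) := by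
    rw [nonsingular_iff' hp.ne_zero, e₁, e₂]
    ring
  refine ⟨Point.some _ _ hns, ?_⟩
  rw [twoDescent_some_of_sq hns (div_ne_zero (mul_ne_zero hpq hcq) hw0) (div_ne_zero hYq hw0) hpq
    rfl e₁, valuationParity_prime_self, valuationParity_prime_of_ne hp2.symm]

lemma exists_twoDescent_eq_zero_torsion (hp2 : p ≠ 2) :
    ∃ P, twoDescent p P = (1, 0, 0, 1) := by
  have hp : p.Prime := Fact.out
  have hpq : (p : ℚ) ≠ 0 := by exact_mod_cast hp.ne_zero
  have h : (congruentCurve p).toAffine.Nonsingular 0 0 := by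
    rw [nonsingular_iff' hp.ne_zero]; ring
  refine ⟨Point.some _ _ h, ?_⟩
  have e₀ : (3 * 0 ^ 2 - (p : ℚ) ^ 2) = -1 * p ^ 2 := by ring
  have e₁ : (0 - (p : ℚ)) = -1 * p := by ring
  have hv (l : ℕ) : valuationParity l (-1) = 0 := by simp [valuationParity]
  have h1 : (-1 : ℚ) ≠ 0 := by norm_num
  rw [twoDescent_apply, descentRep_some, descentRep_some, if_pos rfl, if_neg hpq.symm, e₀, e₁,
    isLogLike_signParity.map_mul_sq h1 hpq, (isLogLike_valuationParity p).map_mul_sq h1 hpq,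
    (isLogLike_valuationParity p).map_mul h1 hpq, (isLogLike_valuationParity 2).map_mul h1 hpq,
    hv, hv, valuationParity_prime_self, valuationParity_prime_of_ne hp2.symm]
  norm_num [signParity]

lemma exists_twoDescent_eq_prime_torsion (hp2 : p ≠ 2) :
    ∃ P, twoDescent p P = (0, 1, 1, 0) := by
  have hp : p.Prime := Fact.out
  have hpq : (p : ℚ) ≠ 0 := by exact_mod_cast hp.ne_zero
  have h : (congruentCurve p).toAffine.Nonsingular p 0 := by
    rw [nonsingular_iff' hp.ne_zero]; ring
  refine ⟨Point.some _ _ h, ?_⟩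
  have e₁ : (3 * (p : ℚ) ^ 2 - (p : ℚ) ^ 2) = (2 : ℕ) * p ^ 2 := by push_cast; ring
  have h2 : ((2 : ℕ) : ℚ) ≠ 0 := by norm_num
  rw [twoDescent_apply, descentRep_some, descentRep_some, if_pos rfl, if_neg hpq, sub_zero, e₁,
    (isLogLike_valuationParity p).map_mul_sq h2 hpq,
    (isLogLike_valuationParity 2).map_mul_sq h2 hpq, valuationParity_prime_self,
    valuationParity_prime_self, valuationParity_prime_of_ne hp2]
  simp [signParity]

lemma twoDescent_surjective (hp2 : p ≠ 2) (h₁ : ∃ P, twoDescent p P = (0, 0, 1, 0))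
    (h₂ : ∃ P, twoDescent p P = (0, 0, 0, 1)) : Function.Surjective (twoDescent p) := by
  obtain ⟨P₁, h₁⟩ := h₁
  obtain ⟨P₂, h₂⟩ := h₂
  obtain ⟨T₁, h₃⟩ := exists_twoDescent_eq_zero_torsion hp2
  obtain ⟨T₂, h₄⟩ := exists_twoDescent_eq_prime_torsion hp2
  have span : ∀ v : ZMod 2 × ZMod 2 × ZMod 2 × ZMod 2, ∃ i j k l : Fin 2,
      i.val • (0, 0, 1, 0) + j.val • (0, 0, 0, 1) + k.val • (1, 0, 0, 1) +
        l.val • (0, 1, 1, 0) = v := by decide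
  intro v
  obtain ⟨i, j, k, l, rfl⟩ := span v
  refine ⟨i.val • P₁ + j.val • P₂ + k.val • T₁ + l.val • T₂, ?_⟩
  simp only [map_add, map_nsmul, h₁, h₂, h₃, h₄]

/-- Surjectivity makes the index #𝔽₂⁴ = 16, and 16 = 2 ^ rank · 4. -/
lemma mordellWeilRank_eq_two (h : Function.Surjective (twoDescent p)) :
    mordellWeilRank (congruentCurve p) = 2 := by
  have hp : p ≠ 0 := (Fact.out : p.Prime).ne_zero
  have hindex :
      (nsmulAddMonoidHom (α := (congruentCurve p).toAffine.Point) 2).range.index = 16 := by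
    rw [← ker_twoDescent, AddSubgroup.index_ker, AddMonoidHom.range_eq_top.mpr h]
    simp
  have := fg_of_finiteIndex hp ⟨by rw [hindex]; norm_num⟩
  have hr := AddCommGroup.index_range_nsmul (congruentCurve p).toAffine.Point 2
  rw [hindex, card_ker_two_nsmul hp] at hr
  have : 2 ^ Module.finrank ℤ (congruentCurve p).toAffine.Point = 2 ^ 2 := by omega
  exact Nat.pow_right_injective le_rfl this

end congruentCurve

theorem mainTheorem6 (p : ℕ) (hp : p.Prime) (hp8 : p ≡ 1 [MOD 8])
    (h₁ : ∃ a b : ℕ, p = a + b ∧ IsSquare ((a : ℤ) - (b : ℤ)) ∧ IsSquare ((a : ℤ) ^ 2 + (b : ℤ) ^ 2))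
    (h₂ : ∃ a b : ℕ, p = a ^ 2 + b ^ 2 ∧ Nat.Coprime a (2 * b) ∧
      (IsSquare (((a : ℤ) + 2 * (b : ℤ)) ^ 2 + (b : ℤ) ^ 2) ∨
        IsSquare (((a : ℤ) - 2 * (b : ℤ)) ^ 2 + (b : ℤ) ^ 2))) :
    mordellWeilRank (congruentCurve p) = 2 := by
  have := Fact.mk hp
  have hp2 : p ≠ 2 := by
    rintro rfl
    exact absurd hp8 (by decide)
  obtain ⟨a, b, hab, hs, ht⟩ := h₁
  obtain ⟨c, d, hcd, -, hsq⟩ := h₂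
  have hcd' : (p : ℤ) = (c : ℤ) ^ 2 + (d : ℤ) ^ 2 := by exact_mod_cast hcd
  refine congruentCurve.mordellWeilRank_eq_two <| congruentCurve.twoDescent_surjective hp2
    (congruentCurve.exists_twoDescent_eq_of_add hp2 hab hs ht) ?_
  rcases hsq with h | h
  · exact congruentCurve.exists_twoDescent_eq_of_sq_add_sq hp2 hcd' h
  -- The minus sign is absorbed by replacing d with -d.
  · refine congruentCurve.exists_twoDescent_eq_of_sq_add_sq hp2 (a := c) (b := -(d : ℤ)) ?_ ?_
    · rw [hcd', neg_sq]
    · rwa [neg_sq, mul_neg, ← sub_eq_add_neg]
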